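/- All rings are commutative with identity and all modules are unitary. For a ring $A$ and an $A$-module $M$, the cotorsion dimension $\mathrm{cd}_A(M)\in\{0,1,2,\dots\}\cup\{\infty\}$ is the least integer $n\ge 0$ such that $\mathrm{Ext}^{n+1}_A(F,M)=0$ for all flat $A$-modules $F$ (and $\infty$ if there is none); the global cotorsion dimension $\mathrm{cot.D}(A)$ is the supremum of $\mathrm{cd}_A(M)$ over all $A$-modules $M$. Write $\mathrm{pd}_A(M)$ for the projective dimension of $M$, with $\mathrm{pd}_A(0)=0$. Theorem. Let $R$ be a ring and let $G$ be an abelian group, written multiplicatively. Let $RG$ be the group ring of $G$ over $R$, and regard $R$ as an $RG$-module with trivial action of $G$ (that is, through the augmentation $RG\to R$, $g\mapsto 1$ for $g\in G$). Then $$\mathrm{cot.D}(R)\le \mathrm{cot.D}(RG)\le \mathrm{cot.D}(R)+\mathrm{pd}_{RG}(R).$$ Furthermore, if $G$ is finite and $\mathrm{pd}_{RG}(R)$ is finite, then $\mathrm{cot.D}(R)=\mathrm{cot.D}(RG)$. -/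

import Mathlib

open CategoryTheory

universe u

noncomputable section

/-- The cotorsion dimension `cd_R(M)`: the least natural number `n` such that
`Ext^{n+1}_R(F, M) = 0` for all flat `R`-modules `F`, and `⊤` if there is none. -/
def cotorsionDimension (R : Type u) [CommRing R] (M : ModuleCat.{u} R) : ℕ∞ :=
  sInf {d : ℕ∞ | ∃ n : ℕ, d = (n : ℕ∞) ∧
    ∀ F : ModuleCat.{u} R, Module.Flat R F → Subsingleton (Abelian.Ext F M (n + 1))}

/-- The global cotorsion dimension `cot.D(R)`: the supremum of the cotorsion dimensions of all
`R`-modules. -/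
def globalCotorsionDimension (R : Type u) [CommRing R] : ℕ∞ :=
  ⨆ M : ModuleCat.{u} R, cotorsionDimension R M

/-- The projective dimension `pd_R(M)` as an element of `ℕ∞`. It is Mathlib's projective
dimension, except that the zero module gets the value `0` instead of `⊥`. -/
def projDim (R : Type u) [CommRing R] (M : ModuleCat.{u} R) : ℕ∞ :=
  (projectiveDimension M).unbotD 0

/-- The augmentation `RG → R`, the `R`-algebra map that sends every `g : G` to `1`. -/
def augmentation (R G : Type u) [CommRing R] [CommGroup G] : MonoidAlgebra R G →ₐ[R] R :=
  MonoidAlgebra.lift R R G 1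

/-- The ring `R` as an `RG`-module with trivial action of `G`, that is, through the
augmentation. -/
def trivialModule (R G : Type u) [CommRing R] [CommGroup G] :
    ModuleCat.{u} (MonoidAlgebra R G) :=
  (ModuleCat.restrictScalars (augmentation R G).toRingHom).obj (ModuleCat.of R R)

end

/-!
Write `A = RG`. Since syzygies of flat modules are flat, `cot.D(R) ≤ n` holds if and only if every
flat `R`-module has projective dimension at most `n` (`globalCotorsionDimension_le_iff`), so the
theorem is about projective dimensions of flat modules.

* Lower bound. For a flat `R`-module `F`, the `A`-module `A ⊗ F` is flat. As `A` is free over `R`,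
  restriction to `R` does not raise projective dimensions, and the augmentation makes `F` a direct
  summand of `A ⊗ F` over `R` (`globalCotorsionDimension_le_of_retraction`).
* Upper bound. For `A`-modules `M` and `F` let `G` act diagonally on `M ⊗ F`, with tensor product
  over `R`. If `M` is `A`-projective and `F` is `R`-projective, then `M ⊗ F` is `A`-projective
  (`DiagonalTensor.projective`), by the adjunction with `Hom_R(F, -)` under the conjugation action.
  Resolving first `F` and then `M` gives `pd_A(M ⊗ F) ≤ pd_R(F) + pd_A(M)` for `R`-projective `M`
  (`DiagonalTensor.hasProjectiveDimensionLT`). For the trivial module `M = R` this reads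
  `pd_A(F) ≤ pd_R(F) + pd_A(R)`, and an `A`-flat module is `R`-flat.
* Finite `G`. The previous bound shows that every `R`-projective `A`-module `C` has
  `pd_A(C) ≤ pd_A(R)`. The norm element embeds `R` in `A` by an `R`-split map, so this applies to the
  cokernel of that embedding; dimension shifting then lowers `pd_A(R)` as long as it is positive and
  finite (`hasProjectiveDimensionLT_of_retraction`). Hence `R` is `A`-projective, and the upper bound
  holds without the summand `pd_A(R)`.
-/

open scoped TensorProduct

/-! ### Projective dimension -/

section Restriction

variable (R : Type u) [CommRing R] {A : Type u} [CommRing A] [Algebra R A] [Module.Free R A]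

lemma Module.Projective.restrictScalars_of_free (M : Type u) [AddCommGroup M] [Module R M]
    [Module A M] [IsScalarTower R A M] [Module.Projective A M] : Module.Projective R M := by
  obtain ⟨s, hs⟩ := Module.projective_def'.mp (inferInstance : Module.Projective A M)
  refine Module.Projective.of_split (M := M →₀ A) (s.restrictScalars R)
    ((Finsupp.linearCombination A id).restrictScalars R) ?_
  ext x
  exact LinearMap.congr_fun hs x

lemma hasProjectiveDimensionLT_one_iff (A : Type u) [Ring A] (M : Type u) [AddCommGroup M]
    [Module A M] :
    HasProjectiveDimensionLT (ModuleCat.of A M) 1 ↔ Module.Projective A M := by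
  rw [← projective_iff_hasProjectiveDimensionLT_one, ← IsProjective.iff_projective]

lemma hasProjectiveDimensionLT_zero_iff_subsingleton (A : Type u) [Ring A] (M : Type u)
    [AddCommGroup M] [Module A M] :
    HasProjectiveDimensionLT (ModuleCat.of A M) 0 ↔ Subsingleton M := by
  rw [hasProjectiveDimensionLT_zero_iff_isZero, ModuleCat.isZero_iff_subsingleton]

lemma shortExact_of_exact {A : Type u} [Ring A] {K P M : Type u} [AddCommGroup K] [AddCommGroup P]
    [AddCommGroup M] [Module A K] [Module A P] [Module A M] (i : K →ₗ[A] P) (f : P →ₗ[A] M)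
    (hi : Function.Injective i) (hf : Function.Surjective f) (h : Function.Exact i f) :
    (ModuleCat.shortComplexOfCompEqZero i f h.linearMap_comp_eq_zero).ShortExact :=
  ModuleCat.shortComplex_shortExact _ h hi hf

/-- Every module is the quotient of a free one; over an `R`-algebra the kernel carries a compatible
`R`-module structure. -/
lemma exists_free_presentation (R A : Type u) [CommRing R] [CommRing A] [Algebra R A]
    (M : Type u) [AddCommGroup M] [Module R M] [Module A M] [IsScalarTower R A M] :
    ∃ (K P : Type u) (_ : AddCommGroup K) (_ : Module R K) (_ : Module A K)
      (_ : IsScalarTower R A K) (_ : AddCommGroup P) (_ : Module R P) (_ : Module A P)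
      (_ : IsScalarTower R A P) (_ : Module.Free A P) (i : K →ₗ[A] P) (f : P →ₗ[A] M),
      Function.Injective i ∧ Function.Surjective f ∧ Function.Exact i f :=
  let f := Finsupp.linearCombination A (id : M → M)
  ⟨LinearMap.ker f, M →₀ A, inferInstance, inferInstance, inferInstance, inferInstance,
    inferInstance, inferInstance, inferInstance, inferInstance, inferInstance,
    (LinearMap.ker f).subtype, f, (LinearMap.ker f).injective_subtype,
    Finsupp.linearCombination_surjective _ Function.surjective_id,
    LinearMap.exact_subtype_ker_map f⟩

/-- Restriction of scalars along a ring extension that is free as a module does not raise the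
projective dimension. -/
lemma hasProjectiveDimensionLT_restrictScalars (n : ℕ) (M : Type u) [AddCommGroup M] [Module R M]
    [Module A M] [IsScalarTower R A M] (h : HasProjectiveDimensionLT (ModuleCat.of A M) n) :
    HasProjectiveDimensionLT (ModuleCat.of R M) n := by
  induction n using Nat.twoStepInduction generalizing M with
  | zero => rwa [hasProjectiveDimensionLT_zero_iff_subsingleton] at h ⊢
  | one =>
    rw [hasProjectiveDimensionLT_one_iff] at h ⊢
    exact Module.Projective.restrictScalars_of_free R (A := A) M
  | more n _ ih =>
    obtain ⟨K, P, _, _, _, _, _, _, _, _, _, i, f, hi, hf, hif⟩ := exists_free_presentation R A M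
    have hP : Module.Projective R P := Module.Projective.restrictScalars_of_free R (A := A) P
    have hK := ((shortExact_of_exact i f hi hf hif).hasProjectiveDimensionLT_X₃_iff n
      ((IsProjective.iff_projective P).mp inferInstance)).mp h
    exact ((shortExact_of_exact (i.restrictScalars R) (f.restrictScalars R) hi hf
      hif).hasProjectiveDimensionLT_X₃_iff n ((IsProjective.iff_projective P).mp hP)).mpr (ih K hK)

end Restriction

/-! ### Cotorsion dimension -/

section Cotorsion

variable (R : Type u) [CommRing R]

lemma Module.Flat.ker_of_surjective {P F : Type u} [AddCommGroup P] [Module R P] [AddCommGroup F]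
    [Module R F] [Module.Flat R P] [Module.Flat R F] (f : P →ₗ[R] F)
    (hf : Function.Surjective f) : Module.Flat R (LinearMap.ker f) := by
  rw [Module.Flat.iff_rTensor_preserves_injective_linearMap]
  intro N N' _ _ _ _ g hg
  -- In the square formed by `N ⊗ ker f`, `N' ⊗ ker f`, `N ⊗ P` and `N' ⊗ P`, the vertical maps
  -- are injective since `F` is flat, the lower one since `P` is flat.
  have h1 := LinearMap.lTensor_injective_of_exact_of_flat f hf _
    (LinearMap.ker f).injective_subtype (LinearMap.exact_subtype_ker_map f) N
  have h2 := Module.Flat.rTensor_preserves_injective_linearMap (M := P) g hg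
  have h3 : Function.Injective ((LinearMap.ker f).subtype.lTensor N' ∘ₗ
      g.rTensor (LinearMap.ker f)) := by
    rw [LinearMap.lTensor_comp_rTensor, ← LinearMap.rTensor_comp_lTensor]
    exact h2.comp h1
  exact Function.Injective.of_comp (f := (LinearMap.ker f).subtype.lTensor N') h3

/-- The vanishing of `Ext^{n+1}(F, M)` for all flat `F` persists in higher degrees, because
syzygies of flat modules are flat. -/
lemma subsingleton_ext_of_le (M : ModuleCat.{u} R) {k n : ℕ} (hkn : k ≤ n)
    (h : ∀ F : ModuleCat.{u} R, Module.Flat R F → Subsingleton (Abelian.Ext F M (k + 1)))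
    (F : ModuleCat.{u} R) (hF : Module.Flat R F) : Subsingleton (Abelian.Ext F M (n + 1)) := by
  induction n, hkn using Nat.le_induction generalizing F with
  | base => exact h F hF
  | succ n _ ih =>
    let f := Finsupp.linearCombination R (id : F → F)
    have hf : Function.Surjective f :=
      Finsupp.linearCombination_surjective _ Function.surjective_id
    have hS := LinearMap.shortExact_shortComplexKer hf
    have : Projective f.shortComplexKer.X₂ :=
      (IsProjective.iff_projective (F →₀ R)).mp inferInstance
    have := ih (ModuleCat.of R (LinearMap.ker f)) (Module.Flat.ker_of_surjective R f hf)
    exact (precomp_extClass_surjective_of_projective_X₂ M hS (n + 1)).subsingleton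

lemma globalCotorsionDimension_le_iff (n : ℕ) :
    globalCotorsionDimension R ≤ n ↔
      ∀ F : ModuleCat.{u} R, Module.Flat R F → HasProjectiveDimensionLT F (n + 1) := by
  constructor
  · intro h F hF
    refine hasProjectiveDimensionLT_of_enoughInjectives F (n + 1) fun M ↦ ?_
    have hM : cotorsionDimension R M < (n + 1 : ℕ) :=
      ((le_iSup _ M).trans h).trans_lt (by exact_mod_cast n.lt_succ_self)
    obtain ⟨_, ⟨k, rfl, hk⟩, hkn⟩ := sInf_lt_iff.mp hM
    have hkn : k ≤ n := Nat.lt_succ_iff.mp (by exact_mod_cast hkn)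
    exact subsingleton_ext_of_le R M hkn hk F hF
  · intro h
    refine iSup_le fun M ↦ sInf_le ⟨n, rfl, fun F hF ↦ ?_⟩
    have := h F hF
    exact HasProjectiveDimensionLT.subsingleton F (n + 1) (n + 1) le_rfl M

/-- A free `R`-algebra `A` with a retraction `A → R` has at least the global cotorsion dimension of
`R`: a flat `R`-module `F` is a direct summand over `R` of the `A`-flat module `A ⊗ F`. -/
lemma globalCotorsionDimension_le_of_retraction (A : Type u) [CommRing A] [Algebra R A]
    [Module.Free R A] (ε : A →ₐ[R] R) :
    globalCotorsionDimension R ≤ globalCotorsionDimension A := by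
  obtain hA | hA := eq_or_ne (globalCotorsionDimension A) ⊤
  · simp [hA]
  obtain ⟨n, hn⟩ := ENat.ne_top_iff_exists.mp hA
  rw [← hn]
  replace hn := hn.ge
  rw [globalCotorsionDimension_le_iff] at hn ⊢
  intro F hF
  have h := hasProjectiveDimensionLT_restrictScalars R (n + 1) (A ⊗[R] F)
    (hn (ModuleCat.of A (A ⊗[R] F)) (inferInstanceAs (Module.Flat A (A ⊗[R] F))))
  let i : F →ₗ[R] A ⊗[R] F := TensorProduct.mk R A F 1
  let r : A ⊗[R] F →ₗ[R] F := TensorProduct.lift ((LinearMap.lsmul R F).comp ε.toLinearMap)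
  have hri : r ∘ₗ i = LinearMap.id := by
    ext x
    simp [r, i]
  exact Retract.hasProjectiveDimensionLT (Y := ModuleCat.of R (A ⊗[R] F))
    ⟨ModuleCat.ofHom i, ModuleCat.ofHom r, ModuleCat.hom_ext hri⟩ (n + 1)

end Cotorsion

/-! ### Group ring modules from representations -/

section RepresentationModule

variable {R G V : Type u} [CommRing R] [CommGroup G] [AddCommGroup V] [Module R V]

/-- The `RG`-module with underlying additive group `V` given by a representation of `G` on `V`.
Unlike `Representation.asModule`, its additive structure is by definition that of an
additive commutative group, so that linear maps over `R` and over `RG` refer to the same one. -/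
def Representation.GroupRingModule (_ : Representation R G V) : Type u := V

variable (ρ : Representation R G V)

instance : AddCommGroup ρ.GroupRingModule := inferInstanceAs (AddCommGroup V)

instance : Module R ρ.GroupRingModule := inferInstanceAs (Module R V)

noncomputable instance : Module (MonoidAlgebra R G) ρ.GroupRingModule :=
  Module.compHom ρ.GroupRingModule (show MonoidAlgebra R G →+* Module.End R ρ.GroupRingModule from
    (MonoidAlgebra.lift R (Module.End R V) G ρ).toRingHom)

/-- The identity map between `V` and the `RG`-module that a representation on `V` defines. -/
def Representation.toGroupRingModule : V ≃ₗ[R] ρ.GroupRingModule := LinearEquiv.refl R V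

lemma Representation.smul_toGroupRingModule (a : MonoidAlgebra R G) (v : V) :
    a • ρ.toGroupRingModule v =
      ρ.toGroupRingModule (MonoidAlgebra.lift R (Module.End R V) G ρ a v) := rfl

lemma Representation.single_smul_toGroupRingModule (g : G) (v : V) :
    MonoidAlgebra.single g (1 : R) • ρ.toGroupRingModule v = ρ.toGroupRingModule (ρ g v) := by
  rw [smul_toGroupRingModule, MonoidAlgebra.lift_single, one_smul]

instance : IsScalarTower R (MonoidAlgebra R G) ρ.GroupRingModule where
  smul_assoc r a x := by
    obtain ⟨v, rfl⟩ := ρ.toGroupRingModule.surjective x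
    simp only [Representation.smul_toGroupRingModule, map_smul, LinearMap.smul_apply]

end RepresentationModule

/-! ### Diagonal tensor products -/

section Diagonal

variable (R G : Type u) [CommRing R] [CommGroup G]

variable (M F : Type u) [AddCommGroup M] [Module R M] [Module (MonoidAlgebra R G) M]
  [IsScalarTower R (MonoidAlgebra R G) M] [AddCommGroup F] [Module R F]
  [Module (MonoidAlgebra R G) F] [IsScalarTower R (MonoidAlgebra R G) F]

/-- The tensor product `M ⊗[R] F` of two `RG`-modules with the diagonal action
`g • (m ⊗ x) = (g • m) ⊗ (g • x)`. -/
abbrev DiagonalTensor : Type u :=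
  ((Representation.ofModule' (k := R) (G := G) M).tprod
    (Representation.ofModule' (k := R) (G := G) F)).GroupRingModule

/-- The module `Hom_R(F, M)` of `R`-linear maps between two `RG`-modules with the conjugation
action `(g • φ) x = g • φ (g⁻¹ • x)`. -/
abbrev ConjugationHom : Type u :=
  ((Representation.ofModule' (k := R) (G := G) F).linHom
    (Representation.ofModule' (k := R) (G := G) M)).GroupRingModule

/-- The identity map from `M ⊗[R] F` to the same group with the diagonal action. -/
noncomputable abbrev DiagonalTensor.mk : M ⊗[R] F ≃ₗ[R] DiagonalTensor R G M F :=
  Representation.toGroupRingModule _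

/-- The identity map from `Hom_R(F, M)` to the same group with the conjugation action. -/
noncomputable abbrev ConjugationHom.mk : (F →ₗ[R] M) ≃ₗ[R] ConjugationHom R G M F :=
  Representation.toGroupRingModule _

variable {R G M F}

lemma DiagonalTensor.single_smul_mk_tmul (g : G) (m : M) (x : F) :
    MonoidAlgebra.single g (1 : R) • mk R G M F (m ⊗ₜ[R] x) =
      mk R G M F
        ((MonoidAlgebra.single g (1 : R) • m) ⊗ₜ[R] (MonoidAlgebra.single g (1 : R) • x)) :=
  Representation.single_smul_toGroupRingModule _ _ _

lemma ConjugationHom.mk_symm_single_smul_apply (g : G) (φ : ConjugationHom R G M F) (x : F) :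
    (mk R G M F).symm (MonoidAlgebra.single g (1 : R) • φ) x =
      MonoidAlgebra.single g (1 : R) •
        (mk R G M F).symm φ (MonoidAlgebra.single g⁻¹ (1 : R) • x) := by
  obtain ⟨φ, rfl⟩ := (mk R G M F).surjective φ
  rw [Representation.single_smul_toGroupRingModule, LinearEquiv.symm_apply_apply,
    LinearEquiv.symm_apply_apply]
  rfl

lemma MonoidAlgebra.single_smul_single_inv_smul {R G F : Type*} [Semiring R] [Group G]
    [AddCommMonoid F] [Module (MonoidAlgebra R G) F] (g : G) (x : F) :
    single g (1 : R) • single g⁻¹ (1 : R) • x = x := by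
  rw [smul_smul, single_mul_single, mul_inv_cancel, one_mul, ← one_def, one_smul]

lemma MonoidAlgebra.single_inv_smul_single_smul {R G F : Type*} [Semiring R] [Group G]
    [AddCommMonoid F] [Module (MonoidAlgebra R G) F] (g : G) (x : F) :
    single g⁻¹ (1 : R) • single g (1 : R) • x = x := by
  rw [smul_smul, single_mul_single, inv_mul_cancel, one_mul, ← one_def, one_smul]

/-- An `R`-linear map out of a diagonal tensor product that commutes with `G` on pure tensors is
`RG`-linear. -/
noncomputable def DiagonalTensor.lift {N : Type u} [AddCommGroup N] [Module R N]
    [Module (MonoidAlgebra R G) N] [IsScalarTower R (MonoidAlgebra R G) N] (f : M ⊗[R] F →ₗ[R] N)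
    (h : ∀ (g : G) (m : M) (x : F),
      f ((MonoidAlgebra.single g (1 : R) • m) ⊗ₜ (MonoidAlgebra.single g (1 : R) • x)) =
        MonoidAlgebra.single g (1 : R) • f (m ⊗ₜ x)) :
    DiagonalTensor R G M F →ₗ[MonoidAlgebra R G] N :=
  MonoidAlgebra.equivariantOfLinearOfComm (f ∘ₗ (mk R G M F).symm.toLinearMap) fun g v ↦ by
    obtain ⟨t, rfl⟩ := (mk R G M F).surjective v
    induction t using TensorProduct.induction_on with
    | zero => simp
    | tmul m x =>
      rw [single_smul_mk_tmul]
      simpa using h g m x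
    | add v w hv hw => rw [map_add, smul_add, map_add, hv, hw, map_add, smul_add]

lemma DiagonalTensor.lift_mk {N : Type u} [AddCommGroup N] [Module R N]
    [Module (MonoidAlgebra R G) N] [IsScalarTower R (MonoidAlgebra R G) N] (f : M ⊗[R] F →ₗ[R] N)
    (h : ∀ (g : G) (m : M) (x : F),
      f ((MonoidAlgebra.single g (1 : R) • m) ⊗ₜ (MonoidAlgebra.single g (1 : R) • x)) =
        MonoidAlgebra.single g (1 : R) • f (m ⊗ₜ x)) (t : M ⊗[R] F) :
    lift f h (mk R G M F t) = f t := by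
  simp [lift]

/-- The tensor product of two `RG`-linear maps is `RG`-linear for the diagonal actions. -/
noncomputable def DiagonalTensor.map {M' F' : Type u} [AddCommGroup M'] [Module R M']
    [Module (MonoidAlgebra R G) M'] [IsScalarTower R (MonoidAlgebra R G) M']
    [AddCommGroup F'] [Module R F']
    [Module (MonoidAlgebra R G) F'] [IsScalarTower R (MonoidAlgebra R G) F']
    (f : M →ₗ[MonoidAlgebra R G] M') (f' : F →ₗ[MonoidAlgebra R G] F') :
    DiagonalTensor R G M F →ₗ[MonoidAlgebra R G] DiagonalTensor R G M' F' :=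
  lift ((mk R G M' F').toLinearMap ∘ₗ
    TensorProduct.map (f.restrictScalars R) (f'.restrictScalars R)) fun g m x ↦ by
      simp [single_smul_mk_tmul]

lemma DiagonalTensor.map_eq {M' F' : Type u} [AddCommGroup M'] [Module R M']
    [Module (MonoidAlgebra R G) M'] [IsScalarTower R (MonoidAlgebra R G) M']
    [AddCommGroup F'] [Module R F']
    [Module (MonoidAlgebra R G) F'] [IsScalarTower R (MonoidAlgebra R G) F']
    (f : M →ₗ[MonoidAlgebra R G] M') (f' : F →ₗ[MonoidAlgebra R G] F') :
    ⇑(map (R := R) f f') = mk R G M' F' ∘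
      TensorProduct.map (f.restrictScalars R) (f'.restrictScalars R) ∘ (mk R G M F).symm :=
  rfl

/-- By the adjunction `Hom_{RG}(M ⊗ F, N) = Hom_{RG}(M, Hom_R(F, N))`, lifting problems for
`M ⊗ F` become lifting problems for `M` against `Hom_R(F, N) → Hom_R(F, N')`, which is surjective
when `F` is `R`-projective. -/
lemma DiagonalTensor.projective [Module.Projective (MonoidAlgebra R G) M] [Module.Projective R F] :
    Module.Projective (MonoidAlgebra R G) (DiagonalTensor R G M F) := by
  refine Module.Projective.of_lifting_property fun {N N'} _ _ _ _ p q hp ↦ ?_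
  let _ : Module R N := Module.restrictScalars R (MonoidAlgebra R G) N
  let _ : Module R N' := Module.restrictScalars R (MonoidAlgebra R G) N'
  have _ : IsScalarTower R (MonoidAlgebra R G) N := .restrictScalars R (MonoidAlgebra R G) N
  have _ : IsScalarTower R (MonoidAlgebra R G) N' := .restrictScalars R (MonoidAlgebra R G) N'
  let pR : N →ₗ[R] N' := p.restrictScalars R
  let qR : M ⊗[R] F →ₗ[R] N' := q.restrictScalars R ∘ₗ (mk R G M F).toLinearMap
  let pHom : ConjugationHom R G N F →ₗ[MonoidAlgebra R G] ConjugationHom R G N' F :=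
    MonoidAlgebra.equivariantOfLinearOfComm ((ConjugationHom.mk R G N' F).toLinearMap ∘ₗ
      LinearMap.compRight R pR ∘ₗ (ConjugationHom.mk R G N F).symm.toLinearMap) fun g φ ↦ by
      refine (ConjugationHom.mk R G N' F).symm.injective (LinearMap.ext fun x ↦ ?_)
      rw [ConjugationHom.mk_symm_single_smul_apply]
      simp [ConjugationHom.mk_symm_single_smul_apply, pR]
  have hpHom : Function.Surjective pHom := fun φ ↦ by
    obtain ⟨ψ, hψ⟩ := Module.projective_lifting_property pR ((ConjugationHom.mk R G N' F).symm φ) hp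
    refine ⟨ConjugationHom.mk R G N F ψ, (ConjugationHom.mk R G N' F).symm.injective ?_⟩
    rw [← hψ]
    ext x
    simp [pHom]
  let qHom : M →ₗ[MonoidAlgebra R G] ConjugationHom R G N' F :=
    MonoidAlgebra.equivariantOfLinearOfComm
      ((ConjugationHom.mk R G N' F).toLinearMap ∘ₗ TensorProduct.curry qR) fun g m ↦ by
      refine (ConjugationHom.mk R G N' F).symm.injective (LinearMap.ext fun x ↦ ?_)
      rw [ConjugationHom.mk_symm_single_smul_apply]
      simp only [LinearMap.comp_apply, LinearEquiv.coe_coe, LinearEquiv.symm_apply_apply,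
        TensorProduct.curry_apply, qR, LinearMap.restrictScalars_apply]
      rw [← map_smul, single_smul_mk_tmul, MonoidAlgebra.single_smul_single_inv_smul]
  obtain ⟨l, hl⟩ := Module.projective_lifting_property pHom qHom hpHom
  let lR : M →ₗ[R] (F →ₗ[R] N) :=
    (ConjugationHom.mk R G N F).symm.toLinearMap ∘ₗ l.restrictScalars R
  have hlR (m : M) (x : F) : p (lR m x) = q (mk R G M F (m ⊗ₜ x)) := by
    have h := congrArg (fun φ ↦ (ConjugationHom.mk R G N' F).symm φ x) (LinearMap.congr_fun hl m)
    simpa [pHom, qHom, pR, qR, lR] using h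
  have hequiv (g : G) (m : M) (x : F) : TensorProduct.lift lR
      ((MonoidAlgebra.single g (1 : R) • m) ⊗ₜ (MonoidAlgebra.single g (1 : R) • x)) =
      MonoidAlgebra.single g (1 : R) • TensorProduct.lift lR (m ⊗ₜ x) := by
    simp only [TensorProduct.lift.tmul, lR, LinearMap.comp_apply, LinearEquiv.coe_coe,
      LinearMap.restrictScalars_apply, map_smul, ConjugationHom.mk_symm_single_smul_apply,
      MonoidAlgebra.single_inv_smul_single_smul]
  refine ⟨lift (TensorProduct.lift lR) hequiv, LinearMap.ext fun v ↦ ?_⟩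
  obtain ⟨t, rfl⟩ := (mk R G M F).surjective v
  rw [LinearMap.comp_apply, lift_mk]
  induction t using TensorProduct.induction_on with
  | zero => simp
  | tmul m x => simpa using hlR m x
  | add v w hv hw => rw [map_add, map_add, map_add, map_add, hv, hw]

section Exact

variable {K P Q : Type u} [AddCommGroup K] [Module R K] [Module (MonoidAlgebra R G) K]
  [IsScalarTower R (MonoidAlgebra R G) K] [AddCommGroup P] [Module R P]
  [Module (MonoidAlgebra R G) P] [IsScalarTower R (MonoidAlgebra R G) P]
  [AddCommGroup Q] [Module R Q] [Module (MonoidAlgebra R G) Q]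
  [IsScalarTower R (MonoidAlgebra R G) Q]
  {i : K →ₗ[MonoidAlgebra R G] P} {f : P →ₗ[MonoidAlgebra R G] Q}

lemma DiagonalTensor.map_injective_right [Module.Flat R M] (hi : Function.Injective i) :
    Function.Injective (map (R := R) (LinearMap.id : M →ₗ[MonoidAlgebra R G] M) i) :=
  Module.Flat.lTensor_preserves_injective_linearMap (M := M) (i.restrictScalars R) hi

lemma DiagonalTensor.map_surjective_right (hf : Function.Surjective f) :
    Function.Surjective (map (R := R) (LinearMap.id : M →ₗ[MonoidAlgebra R G] M) f) :=
  LinearMap.lTensor_surjective M (g := f.restrictScalars R) hf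

lemma DiagonalTensor.map_exact_right (hf : Function.Surjective f) (h : Function.Exact i f) :
    Function.Exact (map (R := R) (LinearMap.id : M →ₗ[MonoidAlgebra R G] M) i)
      (map (R := R) (LinearMap.id : M →ₗ[MonoidAlgebra R G] M) f) :=
  _root_.lTensor_exact M (f := i.restrictScalars R) (g := f.restrictScalars R) h hf

/-- Injectivity survives tensoring with any module when the cokernel is flat over `R`. -/
lemma DiagonalTensor.map_injective_left [Module.Flat R Q] (hi : Function.Injective i)
    (hf : Function.Surjective f) (h : Function.Exact i f) :
    Function.Injective (map (R := R) i (LinearMap.id : F →ₗ[MonoidAlgebra R G] F)) :=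
  (LinearMap.lTensor_inj_iff_rTensor_inj F (i.restrictScalars R)).mp
    (LinearMap.lTensor_injective_of_exact_of_flat (f.restrictScalars R) hf
      (i.restrictScalars R) hi h F)

lemma DiagonalTensor.map_surjective_left (hf : Function.Surjective f) :
    Function.Surjective (map (R := R) f (LinearMap.id : F →ₗ[MonoidAlgebra R G] F)) :=
  LinearMap.rTensor_surjective F (g := f.restrictScalars R) hf

lemma DiagonalTensor.map_exact_left (hf : Function.Surjective f) (h : Function.Exact i f) :
    Function.Exact (map (R := R) i (LinearMap.id : F →ₗ[MonoidAlgebra R G] F))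
      (map (R := R) f (LinearMap.id : F →ₗ[MonoidAlgebra R G] F)) :=
  _root_.rTensor_exact F (f := i.restrictScalars R) (g := f.restrictScalars R) h hf

end Exact

/-- When `M` is projective over `RG`, the projective dimension of `M ⊗ F` over `RG` is bounded by
that of `F` over `R`. -/
lemma DiagonalTensor.hasProjectiveDimensionLT_of_projective
    [Module.Projective (MonoidAlgebra R G) M] (n : ℕ)
    (h : HasProjectiveDimensionLT (ModuleCat.of R F) n) :
    HasProjectiveDimensionLT (ModuleCat.of (MonoidAlgebra R G) (DiagonalTensor R G M F)) n := by
  induction n using Nat.twoStepInduction generalizing F with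
  | zero =>
    rw [hasProjectiveDimensionLT_zero_iff_subsingleton] at h ⊢
    exact (mk R G M F).symm.injective.subsingleton
  | one =>
    rw [hasProjectiveDimensionLT_one_iff] at h ⊢
    exact DiagonalTensor.projective
  | more n _ ih =>
    have : Module.Projective R M :=
      Module.Projective.restrictScalars_of_free R (A := MonoidAlgebra R G) M
    obtain ⟨K, P, _, _, _, _, _, _, _, _, _, i, f, hi, hf, hif⟩ :=
      exists_free_presentation R (MonoidAlgebra R G) F
    have hP : Module.Projective R P :=
      Module.Projective.restrictScalars_of_free R (A := MonoidAlgebra R G) P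
    have hK := ((shortExact_of_exact (i.restrictScalars R) (f.restrictScalars R) hi hf
      hif).hasProjectiveDimensionLT_X₃_iff n ((IsProjective.iff_projective P).mp hP)).mp h
    have hS := shortExact_of_exact _ _ (map_injective_right (M := M) hi)
      (map_surjective_right hf) (map_exact_right hf hif)
    exact (hS.hasProjectiveDimensionLT_X₃_iff n
      ((IsProjective.iff_projective _).mp DiagonalTensor.projective)).mpr (ih hK)

/-- Tensoring an `RG`-resolution of an `R`-projective module `M` with `F` bounds the projective
dimension of `M ⊗ F`. -/
lemma DiagonalTensor.hasProjectiveDimensionLT [Module.Projective R M] (d n : ℕ)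
    (hM : HasProjectiveDimensionLT (ModuleCat.of (MonoidAlgebra R G) M) (d + 1))
    (hF : HasProjectiveDimensionLT (ModuleCat.of R F) (n + 1)) :
    HasProjectiveDimensionLT (ModuleCat.of (MonoidAlgebra R G) (DiagonalTensor R G M F))
      (n + d + 1) := by
  induction d generalizing M with
  | zero =>
    have := (hasProjectiveDimensionLT_one_iff _ M).mp hM
    exact hasProjectiveDimensionLT_of_projective (n + 1) hF
  | succ d ih =>
    obtain ⟨K, P, _, _, _, _, _, _, _, _, _, i, f, hi, hf, hif⟩ :=
      exists_free_presentation R (MonoidAlgebra R G) M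
    have hP : Module.Projective R P :=
      Module.Projective.restrictScalars_of_free R (A := MonoidAlgebra R G) P
    have hK := ((shortExact_of_exact i f hi hf hif).hasProjectiveDimensionLT_X₃_iff d
      ((IsProjective.iff_projective P).mp inferInstance)).mp hM
    have : Module.Projective R K := by
      rw [← hasProjectiveDimensionLT_one_iff] at hP ⊢
      exact (shortExact_of_exact (i.restrictScalars R) (f.restrictScalars R) hi hf
        hif).hasProjectiveDimensionLT_X₁ 1 hP (hasProjectiveDimensionLT_of_ge _ 1 _ (by lia))
    have hS := shortExact_of_exact _ _ (map_injective_left (F := F) hi hf hif)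
      (map_surjective_left hf) (map_exact_left hf hif)
    have hPF := hasProjectiveDimensionLT_of_projective (G := G) (M := P) (n + 1) hF
    exact hS.hasProjectiveDimensionLT_X₃ (n + d + 1) (ih hK)
      (hasProjectiveDimensionLT_of_ge _ (n + 1) _ (by lia))

end Diagonal

/-! ### The trivial module -/

section Trivial

variable (R G : Type u) [CommRing R] [CommGroup G]

noncomputable instance : Module R (trivialModule R G) :=
  Module.restrictScalars R (MonoidAlgebra R G) (trivialModule R G)

instance : IsScalarTower R (MonoidAlgebra R G) (trivialModule R G) :=
  .restrictScalars R (MonoidAlgebra R G) (trivialModule R G)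

/-- The underlying `R`-module of the trivial module is `R`. -/
noncomputable def trivialModuleEquiv : trivialModule R G ≃ₗ[R] R where
  toFun x := x
  invFun x := x
  left_inv _ := rfl
  right_inv _ := rfl
  map_add' _ _ := rfl
  map_smul' r (x : R) :=
    show augmentation R G (algebraMap R (MonoidAlgebra R G) r) * x = r * x by
      rw [AlgHom.commutes, Algebra.algebraMap_self_apply]

lemma single_smul_trivialModule (g : G) (x : trivialModule R G) :
    MonoidAlgebra.single g (1 : R) • x = x :=
  show augmentation R G (MonoidAlgebra.single g (1 : R)) * (show R from x) = (show R from x) by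
    rw [augmentation, MonoidAlgebra.lift_single, MonoidHom.one_apply, one_smul, one_mul]

variable {R G}
variable {F : Type u} [AddCommGroup F] [Module R F]
  [Module (MonoidAlgebra R G) F] [IsScalarTower R (MonoidAlgebra R G) F]

/-- The trivial module is a unit for the diagonal tensor product. -/
noncomputable def DiagonalTensor.leftUnitor :
    DiagonalTensor R G (trivialModule R G) F ≃ₗ[MonoidAlgebra R G] F :=
  LinearEquiv.ofBijective
    (lift (((trivialModuleEquiv R G).rTensor F ≪≫ₗ TensorProduct.lid R F).toLinearMap)
      fun g m x ↦ by
        simp only [single_smul_trivialModule, LinearEquiv.coe_coe, LinearEquiv.trans_apply,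
          LinearEquiv.rTensor_tmul, TensorProduct.lid_tmul]
        rw [smul_comm])
    (((mk R G (trivialModule R G) F).symm ≪≫ₗ (trivialModuleEquiv R G).rTensor F ≪≫ₗ
      TensorProduct.lid R F).bijective)

/-- The bound `pd_{RG}(F) ≤ pd_R(F) + pd_{RG}(R)`, obtained from `F ≅ R ⊗ F`. -/
lemma hasProjectiveDimensionLT_of_trivialModule (d n : ℕ)
    (hT : HasProjectiveDimensionLT (trivialModule R G) (d + 1))
    (hF : HasProjectiveDimensionLT (ModuleCat.of R F) (n + 1)) :
    HasProjectiveDimensionLT (ModuleCat.of (MonoidAlgebra R G) F) (n + d + 1) := by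
  have : Module.Projective R (trivialModule R G) :=
    Module.Projective.of_equiv' (trivialModuleEquiv R G).symm
  have hT' : HasProjectiveDimensionLT
      (ModuleCat.of (MonoidAlgebra R G) (trivialModule R G)) (d + 1) := hT
  have := DiagonalTensor.hasProjectiveDimensionLT d n hT' hF
  exact hasProjectiveDimensionLT_of_iso
    (DiagonalTensor.leftUnitor (R := R) (G := G) (F := F)).toModuleIso _

lemma globalCotorsionDimension_monoidAlgebra_le (d n : ℕ)
    (hT : HasProjectiveDimensionLT (trivialModule R G) (d + 1))
    (hR : globalCotorsionDimension R ≤ n) :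
    globalCotorsionDimension (MonoidAlgebra R G) ≤ (n + d : ℕ) := by
  rw [globalCotorsionDimension_le_iff] at hR ⊢
  intro F hF
  let _ : Module R F := Module.restrictScalars R (MonoidAlgebra R G) F
  have _ : IsScalarTower R (MonoidAlgebra R G) F := .restrictScalars R (MonoidAlgebra R G) F
  have : Module.Flat R F := Module.Flat.trans R (MonoidAlgebra R G) F
  exact hasProjectiveDimensionLT_of_trivialModule (F := F) d n hT (hR (ModuleCat.of R F) this)

lemma projDim_le_iff (A : Type u) [CommRing A] (M : ModuleCat.{u} A) (n : ℕ) :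
    projDim A M ≤ n ↔ HasProjectiveDimensionLT M (n + 1) := by
  rw [projDim, WithBot.unbotD_le_iff (fun _ ↦ zero_le)]
  exact projectiveDimension_le_iff M n

lemma exists_hasProjectiveDimensionLT_of_projDim_ne_top {A : Type u} [CommRing A]
    {M : ModuleCat.{u} A} (h : projDim A M ≠ ⊤) :
    ∃ d : ℕ, projDim A M = d ∧ HasProjectiveDimensionLT M (d + 1) := by
  obtain ⟨d, hd⟩ := ENat.ne_top_iff_exists.mp h
  exact ⟨d, hd.symm, (projDim_le_iff A M d).mp hd.ge⟩

end Trivial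

/-! ### Finite groups -/

section Finite

variable {R G : Type u} [CommRing R] [CommGroup G]

/-- The embedding of the trivial module, `1 ↦ ∑ g` with `g` running through `G`, in the group
ring of a finite group. -/
noncomputable def normEmbedding (R G : Type u) [CommRing R] [CommGroup G] [Fintype G] :
    trivialModule R G →ₗ[MonoidAlgebra R G] MonoidAlgebra R G :=
  MonoidAlgebra.equivariantOfLinearOfComm
    ((LinearMap.toSpanSingleton R (MonoidAlgebra R G) (∑ g : G, MonoidAlgebra.single g 1)) ∘ₗ
      (trivialModuleEquiv R G).toLinearMap) fun g x ↦ by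
    rw [single_smul_trivialModule, LinearMap.comp_apply, LinearMap.toSpanSingleton_apply,
      smul_comm, smul_eq_mul, Finset.mul_sum]
    congr 1
    simp only [MonoidAlgebra.single_mul_single, one_mul]
    exact (Fintype.sum_equiv (Equiv.mulLeft g) _ _ fun _ ↦ rfl).symm

/-- The coefficient at `1` is an `R`-linear retraction of the norm embedding. -/
lemma exists_retraction_normEmbedding [Fintype G] :
    ∃ l : MonoidAlgebra R G →ₗ[R] trivialModule R G,
      l ∘ₗ (normEmbedding R G).restrictScalars R = LinearMap.id := by
  classical
  refine ⟨(trivialModuleEquiv R G).symm.toLinearMap ∘ₗ Finsupp.lapply 1 ∘ₗ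
    (MonoidAlgebra.coeffLinearEquiv R).toLinearMap, ?_⟩
  ext x
  obtain ⟨r, rfl⟩ := (trivialModuleEquiv R G).symm.surjective x
  simp [normEmbedding, Finsupp.single_apply]

/-- Dimension shifting along an embedding in a projective module: if `K` embeds in `P` by an
`R`-split map with cokernel `C`, then `C` is `R`-projective, so that the bound `d + 1` on the
projective dimension of the trivial module is one for `C` too, and `d` is a bound for `K`. -/
lemma hasProjectiveDimensionLT_of_retraction {K P C : Type u} [AddCommGroup K] [Module R K]
    [Module (MonoidAlgebra R G) K] [IsScalarTower R (MonoidAlgebra R G) K] [AddCommGroup P]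
    [Module R P] [Module (MonoidAlgebra R G) P] [IsScalarTower R (MonoidAlgebra R G) P]
    [AddCommGroup C] [Module R C] [Module (MonoidAlgebra R G) C]
    [IsScalarTower R (MonoidAlgebra R G) C] [Module.Projective (MonoidAlgebra R G) P]
    (i : K →ₗ[MonoidAlgebra R G] P) (q : P →ₗ[MonoidAlgebra R G] C) (hq : Function.Surjective q)
    (hiq : Function.Exact i q) (l : P →ₗ[R] K) (hl : l ∘ₗ i.restrictScalars R = LinearMap.id)
    (d : ℕ) (h : HasProjectiveDimensionLT (trivialModule R G) (d + 2)) :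
    HasProjectiveDimensionLT (ModuleCat.of (MonoidAlgebra R G) K) (d + 1) := by
  have hi : Function.Injective i :=
    Function.LeftInverse.injective (g := l) (LinearMap.congr_fun hl)
  have hC : Module.Projective R C := by
    have : Module.Projective R P :=
      Module.Projective.restrictScalars_of_free R (A := MonoidAlgebra R G) P
    have hiqR : Function.Exact (i.restrictScalars R) (q.restrictScalars R) := hiq
    have hiR : Function.Injective (i.restrictScalars R) := hi
    have hqR : Function.Surjective (q.restrictScalars R) := hq
    have hsplit : (∃ s, q.restrictScalars R ∘ₗ s = LinearMap.id) ↔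
        ∃ l, l ∘ₗ i.restrictScalars R = LinearMap.id := (hiqR.split_tfae hiR hqR).out 0 1
    obtain ⟨s, hs⟩ := hsplit.mpr ⟨l, hl⟩
    exact Module.Projective.of_split s (q.restrictScalars R) hs
  have hCd : HasProjectiveDimensionLT (ModuleCat.of (MonoidAlgebra R G) C) (0 + (d + 1) + 1) :=
    hasProjectiveDimensionLT_of_trivialModule (d + 1) 0 h
      ((hasProjectiveDimensionLT_one_iff R C).mpr hC)
  rw [zero_add] at hCd
  have hP := (hasProjectiveDimensionLT_one_iff (MonoidAlgebra R G) P).mpr inferInstance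
  exact (shortExact_of_exact i q hi hq hiq).hasProjectiveDimensionLT_X₁ (d + 1)
    (hasProjectiveDimensionLT_of_ge _ 1 _ (by lia)) hCd

/-- The case of the norm embedding of the trivial module in `RG`, whose projective dimension thus
drops until it is `0`. -/
lemma hasProjectiveDimensionLT_trivialModule_pred [Finite G] (d : ℕ)
    (h : HasProjectiveDimensionLT (trivialModule R G) (d + 2)) :
    HasProjectiveDimensionLT (trivialModule R G) (d + 1) := by
  have _ := Fintype.ofFinite G
  obtain ⟨l, hl⟩ := exists_retraction_normEmbedding (R := R) (G := G)
  exact hasProjectiveDimensionLT_of_retraction (normEmbedding R G)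
    (LinearMap.range (normEmbedding R G)).mkQ (Submodule.mkQ_surjective _)
    (LinearMap.exact_map_mkQ_range _) l hl d h

/-- For finite `G`, the trivial module of finite projective dimension is projective. -/
lemma hasProjectiveDimensionLT_trivialModule_one [Finite G] (d : ℕ)
    (h : HasProjectiveDimensionLT (trivialModule R G) (d + 1)) :
    HasProjectiveDimensionLT (trivialModule R G) 1 := by
  induction d with
  | zero => exact h
  | succ d ih => exact ih (hasProjectiveDimensionLT_trivialModule_pred d h)

end Finite

theorem theorem2p10 (R G : Type u) [CommRing R] [CommGroup G] :
    (globalCotorsionDimension R ≤ globalCotorsionDimension (MonoidAlgebra R G) ∧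
      globalCotorsionDimension (MonoidAlgebra R G) ≤
        globalCotorsionDimension R + projDim (MonoidAlgebra R G) (trivialModule R G)) ∧
    (Finite G → projDim (MonoidAlgebra R G) (trivialModule R G) ≠ ⊤ →
      globalCotorsionDimension R = globalCotorsionDimension (MonoidAlgebra R G)) := by
  have h₁ : globalCotorsionDimension R ≤ globalCotorsionDimension (MonoidAlgebra R G) :=
    globalCotorsionDimension_le_of_retraction R (MonoidAlgebra R G) (augmentation R G)
  refine ⟨⟨h₁, ?_⟩, fun _ hT ↦ le_antisymm h₁ ?_⟩
  · obtain hR | hR := eq_or_ne (globalCotorsionDimension R) ⊤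
    · simp [hR]
    obtain hT | hT := eq_or_ne (projDim (MonoidAlgebra R G) (trivialModule R G)) ⊤
    · simp [hT]
    obtain ⟨n, hn⟩ := ENat.ne_top_iff_exists.mp hR
    obtain ⟨d, hd, hTd⟩ := exists_hasProjectiveDimensionLT_of_projDim_ne_top hT
    rw [hd, ← hn]
    exact_mod_cast globalCotorsionDimension_monoidAlgebra_le d n hTd hn.ge
  · obtain hR | hR := eq_or_ne (globalCotorsionDimension R) ⊤
    · simp [hR]
    obtain ⟨n, hn⟩ := ENat.ne_top_iff_exists.mp hR
    obtain ⟨d, _, hTd⟩ := exists_hasProjectiveDimensionLT_of_projDim_ne_top hT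
    rw [← hn]
    -- The trivial module is projective here, so its contribution to the bound is `0`.
    exact globalCotorsionDimension_monoidAlgebra_le 0 n
      (hasProjectiveDimensionLT_trivialModule_one d hTd) hn.ge
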